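/- Fix $\tau\in(3,4)$ and put $\alpha=1/(\tau-1)$, $\eta=(\tau-3)/(\tau-1)$. For each $n\ge 1$ let $\boldsymbol d_n=(d_1,\dots,d_n)$ (dependence on $n$ suppressed) be non-negative integers with $d_1\ge d_2\ge\dots\ge d_n$ and $\ell_n=\sum_{i\le n}d_i$ even. Let $\mathrm{CM}_n(\boldsymbol d)$ be the configuration model: the multigraph on $\{1,\dots,n\}$ obtained by attaching $d_i$ half-edges to vertex $i$ and matching the $\ell_n$ half-edges in pairs uniformly at random, each pair forming an edge. Assume the following as $n\to\infty$. *General assumptions.* (i) For each fixed $i\ge1$, $n^{-\alpha}d_i\to\theta_i$, where $\theta_1\ge\theta_2\ge\cdots$, $\sum_i\theta_i^3<\infty$ and $\sum_i\theta_i^2=\infty$. (ii) The degree $D_n$ of a uniformly chosen vertex converges in distribution to a random variable $D$ with values in $\{0,1,2,\dots\}$ and $E[D^2]<\infty$; moreover $\frac1n\sum_{i\le n}d_i\to E[D]$, $\frac1n\sum_{i\le n}d_i^2\to E[D^2]$, and $$\lim_{K\to\infty}\limsup_{n\to\infty}n^{-3\alpha}\sum_{i=K+1}^n d_i^3=0.$$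 (iii) The number of vertices of degree one is $\Theta(n)$. *Criticality.* For some $\lambda\in\mathbb R$, $$\nu_n=\frac{\sum_{i\le n}d_i(d_i-1)}{\sum_{i\le n}d_i}=1+\lambda n^{-\eta}+o(n^{-\eta}).$$ *Extra assumptions.* (i) There is $c_0>0$ such that, for all $n\ge1$ and all integers $1\le l\le d_1$, $\sum_{i:\,d_i\ge l}d_i/\ell_n\ge c_0\,l^{-(\tau-2)}$. (ii) With $\beta_i^n=n^{-2\alpha}\sum_{j=1}^{i-1}d_j^2$, there is a sequence of integers $K_n\to\infty$ with $K_n=o(n^\alpha)$ and $\log n=o(\beta^n_{K_n})$. (iii) For this sequence $(K_n)$ and every $\varepsilon>0$, $$\lim_{K\to\infty}\limsup_{n\to\infty}\sum_{K<i<K_n}\frac{d_i}{n^\alpha}\,e^{-\varepsilon\beta_i^n}=0.$$ Let $\mathcal G_n^{>K}$ be the graph obtained from $\mathrm{CM}_n(\boldsymbol d)$ by removing the vertices $1,\dots,K$ (those of highest degree) together with all edges incident to them, and let $\Delta^{>K}$ be the maximum of the graph-distance diameters of the connected components of $\mathcal G_n^{>K}$ (and $0$ if no vertex is left). Then for all $\varepsilon_1,\varepsilon_2>0$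 there exist integers $K\ge1$ and $n_0$ such that for all $n\ge n_0$, $$P\big(\Delta^{>K}>\varepsilon_1 n^{\eta}\big)\le\frac{\varepsilon_2}{4}.$$ -/

import Mathlib

open Filter Topology Asymptotics

namespace CritCM

/-! ### Exponents -/

/-- `α = 1 / (τ - 1)`. -/
noncomputable def alphaExp (τ : ℝ) : ℝ := 1 / (τ - 1)

/-- `η = (τ - 3) / (τ - 1)`. -/
noncomputable def etaExp (τ : ℝ) : ℝ := (τ - 3) / (τ - 1)

/-! ### The configuration model -/

/-- The half-edges: vertex `i` carries `d i` of them. -/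
abbrev HalfEdge {n : ℕ} (d : Fin n → ℕ) : Type := Σ i : Fin n, Fin (d i)

/-- A perfect matching of the half-edges, as a fixed-point-free involution. -/
def Pairing {n : ℕ} (d : Fin n → ℕ) : Type :=
  {σ : Equiv.Perm (HalfEdge d) // (∀ h, σ (σ h) = h) ∧ ∀ h, σ h ≠ h}

instance {n : ℕ} (d : Fin n → ℕ) : MeasurableSpace (Pairing d) := ⊤

/-- The law of the configuration model: the uniform distribution on the perfect matchings of
the half-edges. -/
noncomputable def configLaw {n : ℕ} (d : Fin n → ℕ) : MeasureTheory.Measure (Pairing d) :=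
  ProbabilityTheory.uniformOn Set.univ

/-- The graph on the vertex set given by a pairing. Graph distances are not affected by
self-loops and multiple edges, so only the underlying simple graph is recorded. -/
def configGraph {n : ℕ} {d : Fin n → ℕ} (σ : Pairing d) : SimpleGraph (Fin n) where
  Adj u v := u ≠ v ∧ ∃ h : HalfEdge d, h.1 = u ∧ (σ.1 h).1 = v
  symm := ⟨fun u v => by
    rintro ⟨huv, h, hu, hv⟩
    exact ⟨huv.symm, σ.1 h, hv, by rw [σ.2.1 h]; exact hu⟩⟩
  loopless := ⟨fun _ h => h.1 rfl⟩

/-- The graph with the first `K` vertices, and the edges incident to them, removed. The vertex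
`i : Fin n` has label `i + 1` in `{1, …, n}`. -/
def removeHubs {n : ℕ} (K : ℕ) (G : SimpleGraph (Fin n)) :
    SimpleGraph {i : Fin n // K < (i : ℕ) + 1} :=
  G.comap Subtype.val

/-- The maximum of the diameters of the connected components of a graph (meant for finite
graphs; it is `0` if there are no vertices). -/
noncomputable def maxComponentDiam {V : Type} (G : SimpleGraph V) : ℕ :=
  ⨆ C : G.ConnectedComponent, C.toSimpleGraph.diam

/-! ### Conditions on the degree sequences

`d n i` is the degree of the vertex with label `i + 1` in the `n`-th degree sequence. -/

/-- `limsup_{n → ∞} f K n → 0` as `K → ∞`, for a nonnegative function `f`; the upper limit is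
taken in `[0, ∞]`. -/
def IteratedLimsupZero (f : ℕ → ℕ → ℝ) : Prop :=
  Tendsto (fun K => limsup (fun n => ENNReal.ofReal (f K n)) atTop) atTop (𝓝 0)

/-- The total degree `ℓ_n`. -/
def totalDegree {n : ℕ} (d : Fin n → ℕ) : ℕ := ∑ i, d i

/-- The number of vertices of degree `k`. -/
def degreeCount {n : ℕ} (d : Fin n → ℕ) (k : ℕ) : ℕ := (Finset.univ.filter fun i => d i = k).card

/-- The general assumptions on the degree sequences. -/
structure GeneralAssumptions (τ : ℝ) (θ : ℕ → ℝ) (d : (n : ℕ) → Fin n → ℕ) : Prop where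
  /-- `θ i` is the limit belonging to the vertex with label `i + 1`. -/
  highDegree : ∀ i : ℕ, Tendsto
    (fun n : ℕ => if h : i < n then (n : ℝ) ^ (-alphaExp τ) * (d n ⟨i, h⟩ : ℝ) else 0)
    atTop (𝓝 (θ i))
  theta_antitone : Antitone θ
  theta_cube : Summable fun i => θ i ^ 3
  theta_sq : ¬ Summable fun i => θ i ^ 2
  /-- The degree of a uniform vertex converges in distribution to a random variable with
  probability mass function `p`, which has finite first and second moments `μ` and `μ₂`, and the
  first two moments converge to these. -/
  moments : ∃ (p : PMF ℕ) (μ μ₂ : ℝ),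
    (∀ k : ℕ, Tendsto (fun n : ℕ => (degreeCount (d n) k : ℝ) / n) atTop (𝓝 (p k).toReal)) ∧
    HasSum (fun k : ℕ => (k : ℝ) * (p k).toReal) μ ∧
    HasSum (fun k : ℕ => (k : ℝ) ^ 2 * (p k).toReal) μ₂ ∧
    Tendsto (fun n : ℕ => (1 / (n : ℝ)) * ∑ i, (d n i : ℝ)) atTop (𝓝 μ) ∧
    Tendsto (fun n : ℕ => (1 / (n : ℝ)) * ∑ i, (d n i : ℝ) ^ 2) atTop (𝓝 μ₂)
  thirdMoment : IteratedLimsupZero fun K n =>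
    (n : ℝ) ^ (-(3 * alphaExp τ)) *
      ∑ i ∈ Finset.univ.filter (fun i : Fin n => K < (i : ℕ) + 1), (d n i : ℝ) ^ 3
  degreeOne : (fun n : ℕ => (degreeCount (d n) 1 : ℝ)) =Θ[atTop] fun n : ℕ => (n : ℝ)

/-- The criticality parameter `ν_n`. -/
noncomputable def nu {n : ℕ} (d : Fin n → ℕ) : ℝ :=
  (∑ i, (d i : ℝ) * ((d i : ℝ) - 1)) / (totalDegree d : ℝ)

/-- `ν_n = 1 + lam * n ^ (-η) + o(n ^ (-η))`. -/
def Critical (τ lam : ℝ) (d : (n : ℕ) → Fin n → ℕ) : Prop :=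
  (fun n : ℕ => nu (d n) - (1 + lam * (n : ℝ) ^ (-etaExp τ))) =o[atTop]
    fun n : ℕ => (n : ℝ) ^ (-etaExp τ)

/-- `P(D_n^* ≥ l)`, where `D_n^*` is the degree of a vertex chosen with probabilities
`d i / ℓ_n`. -/
noncomputable def sizeBiasedTail {n : ℕ} (d : Fin n → ℕ) (l : ℕ) : ℝ :=
  ∑ i ∈ Finset.univ.filter (fun i => l ≤ d i), (d i : ℝ) / (totalDegree d : ℝ)

/-- `β_i^n = n ^ (-2α) * ∑_{j = 1}^{i - 1} d_j ^ 2`, with labels `i` and `j` starting at `1`. -/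
noncomputable def beta (τ : ℝ) {n : ℕ} (d : Fin n → ℕ) (i : ℕ) : ℝ :=
  (n : ℝ) ^ (-(2 * alphaExp τ)) *
    ∑ j ∈ Finset.univ.filter (fun j : Fin n => (j : ℕ) + 1 < i), (d j : ℝ) ^ 2

/-- The additional assumptions on the degree sequences. -/
structure ExtraAssumptions (τ : ℝ) (d : (n : ℕ) → Fin n → ℕ) : Prop where
  sizeBiased : ∃ c₀ : ℝ, 0 < c₀ ∧ ∀ (n : ℕ) (hn : 0 < n) (l : ℕ), 1 ≤ l → l ≤ d n ⟨0, hn⟩ →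
    c₀ / (l : ℝ) ^ (τ - 2) ≤ sizeBiasedTail (d n) l
  cutoff : ∃ Kn : ℕ → ℕ,
    Tendsto Kn atTop atTop ∧
    ((fun n : ℕ => (Kn n : ℝ)) =o[atTop] fun n : ℕ => (n : ℝ) ^ alphaExp τ) ∧
    ((fun n : ℕ => Real.log (n : ℝ)) =o[atTop] fun n : ℕ => beta τ (d n) (Kn n)) ∧
    ∀ ε : ℝ, 0 < ε → IteratedLimsupZero fun K n =>
      ∑ i ∈ Finset.univ.filter (fun i : Fin n => K < (i : ℕ) + 1 ∧ (i : ℕ) + 1 < Kn n),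
        ((d n i : ℝ) / (n : ℝ) ^ alphaExp τ) *
          Real.exp (-(ε * beta τ (d n) ((i : ℕ) + 1)))

end CritCM

namespace CritCM

/-! ### Revealing edges of a uniform matching -/

section Matching

/-! A component of large diameter contains a long geodesic issuing from its vertex of smallest index
`i`: some vertex lies at distance at least half the diameter from `i`, and every other vertex on the
geodesic has index larger than `i`. By a union bound over the half-edges of all `i` outside the
removed hubs, it suffices to bound the probability that a given half-edge of `i` starts a
self-avoiding path of order `n^η` steps among the vertices `v > i`.

Revealing the path edge by edge, with at least `N` free half-edges at each step, gives the recursion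
`reachBound` (`card_filter_reaches_le`), similar to that for the survival probability of a branching
process with size-biased offspring. The truncation `min 1` is essential: together with the lower
bound on the size-biased tail it yields `q_{r+1} ≤ (1 + O(n^{-η})) q_r - c q_r^{τ-2}`
(`sum_mul_min_le`). Hence `q` falls to order `n^{-α}` within a small multiple of `n^η` steps
(`le_of_sub_rpow_step`), the exponents matching because `α(τ-3) = η`.

Since the path avoids the vertices up to `i`, the mean offspring is at most `1 - const * n^{-η} β_i`
once `β_i` is large, so another stretch of order `n^η` steps contributes a factor `exp(-κ β_i)`
(`reachBound_add_le`, `exists_eventually_reachBound_le`). The remaining sum of `d_i n^{-α} exp(-κ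
β_i)` is small by the extra assumptions: below the cutoff `K_n` it is the sum assumed to vanish, and
from `K_n` on the exponential is at most `n^{-2}`. -/

open Classical in
noncomputable instance {n : ℕ} (d : Fin n → ℕ) : Fintype (Pairing d) :=
  inferInstanceAs (Fintype {σ : Equiv.Perm (HalfEdge d) // (∀ h, σ (σ h) = h) ∧ ∀ h, σ h ≠ h})

variable {n : ℕ} {d : Fin n → ℕ}

/-- Conjugation of a pairing by a transposition. -/
def conjSwap (a b : HalfEdge d) (σ : Pairing d) : Pairing d :=
  ⟨Equiv.swap a b * σ.1 * Equiv.swap a b, by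
    refine ⟨fun h => ?_, fun h hh => ?_⟩
    · simp [Equiv.Perm.mul_apply, σ.2.1]
    · have := congrArg (Equiv.swap a b) hh
      simp only [Equiv.Perm.mul_apply, Equiv.swap_apply_self] at this
      exact σ.2.2 _ this⟩

lemma conjSwap_apply (a b : HalfEdge d) (σ : Pairing d) (h : HalfEdge d) :
    (conjSwap a b σ).1 h = Equiv.swap a b (σ.1 (Equiv.swap a b h)) := rfl

lemma conjSwap_conjSwap (a b : HalfEdge d) (σ : Pairing d) :
    conjSwap a b (conjSwap a b σ) = σ := by
  apply Subtype.ext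
  ext1 h
  simp [conjSwap_apply]

/-- A family of pairings that only constrains the half-edges in `X`, which are paired among
themselves. -/
def ConstrainedOn (E : Finset (Pairing d)) (X : Finset (HalfEdge d)) : Prop :=
  (∀ σ ∈ E, ∀ h ∈ X, σ.1 h ∈ X) ∧
    ∀ σ ∈ E, ∀ a, a ∉ X → ∀ b, b ∉ X → conjSwap a b σ ∈ E

lemma constrainedOn_univ : ConstrainedOn (Finset.univ : Finset (Pairing d)) ∅ := by
  simp [ConstrainedOn]

/-- Transpositions of half-edges other than `h` and `k` do not disturb the revealed edge, so
conditioning on one more edge stays within this class. -/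
lemma ConstrainedOn.filter {E : Finset (Pairing d)} {X : Finset (HalfEdge d)}
    (hE : ConstrainedOn E X) (h k : HalfEdge d) :
    ConstrainedOn (E.filter fun σ => σ.1 h = k) (insert h (insert k X)) := by
  refine ⟨fun σ hσ g hg => ?_, fun σ hσ a ha b hb => ?_⟩
  · obtain ⟨hσE, rfl⟩ := Finset.mem_filter.1 hσ
    simp only [Finset.mem_insert] at hg ⊢
    rcases hg with rfl | rfl | hg
    · simp
    · simp [σ.2.1]
    · exact Or.inr (Or.inr (hE.1 σ hσE g hg))
  · obtain ⟨hσE, rfl⟩ := Finset.mem_filter.1 hσ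
    simp only [Finset.mem_insert, not_or] at ha hb
    refine Finset.mem_filter.2 ⟨hE.2 σ hσE a ha.2.2 b hb.2.2, ?_⟩
    rw [conjSwap_apply, Equiv.swap_apply_of_ne_of_ne (Ne.symm ha.1) (Ne.symm hb.1),
      Equiv.swap_apply_of_ne_of_ne (Ne.symm ha.2.1) (Ne.symm hb.2.1)]

/-- Conjugation by the transposition of `k` and `k'` is an injection between the two classes; it
preserves `E` because both half-edges are free. -/
lemma ConstrainedOn.card_filter_le {E : Finset (Pairing d)} {X : Finset (HalfEdge d)}
    (hE : ConstrainedOn E X) {h k k' : HalfEdge d} (hk : k ∉ X) (hk' : k' ∉ X)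
    (hne : h ≠ k) (hne' : h ≠ k') :
    (E.filter fun σ => σ.1 h = k).card ≤ (E.filter fun σ => σ.1 h = k').card := by
  refine Finset.card_le_card_of_injOn (conjSwap k k') (fun σ hσ => ?_) (fun σ _ ρ _ hσρ => ?_)
  · obtain ⟨hσE, rfl⟩ := Finset.mem_filter.1 hσ
    refine Finset.mem_coe.2 (Finset.mem_filter.2 ⟨hE.2 σ hσE _ hk _ hk', ?_⟩)
    rw [conjSwap_apply, Equiv.swap_apply_of_ne_of_ne hne hne', Equiv.swap_apply_left]
  · rw [← conjSwap_conjSwap k k' σ, hσρ, conjSwap_conjSwap]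

/-- By symmetry the partner of `h` is uniform over the free half-edges other than `h`. -/
lemma ConstrainedOn.card_filter_mul {E : Finset (Pairing d)} {X : Finset (HalfEdge d)}
    (hE : ConstrainedOn E X) {h k : HalfEdge d} (hh : h ∉ X) (hk : k ∉ X) (hne : h ≠ k) :
    (E.filter fun σ => σ.1 h = k).card * (Fintype.card (HalfEdge d) - (X.card + 1)) = E.card := by
  have hmap : ∀ σ ∈ E, σ.1 h ∈ Finset.univ \ insert h X := by
    intro σ hσ
    simp only [Finset.mem_sdiff, Finset.mem_univ, true_and, Finset.mem_insert, not_or]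
    exact ⟨σ.2.2 h, fun hX => hh (by simpa [σ.2.1] using hE.1 σ hσ _ hX)⟩
  rw [Finset.card_eq_sum_card_fiberwise hmap,
    Finset.sum_congr rfl (fun k' hk' => ?_), Finset.sum_const, smul_eq_mul, mul_comm,
    Finset.card_sdiff_of_subset (Finset.subset_univ _), Finset.card_insert_of_notMem hh,
    Finset.card_univ]
  simp only [Finset.mem_sdiff, Finset.mem_univ, true_and, Finset.mem_insert, not_or] at hk'
  exact le_antisymm (hE.card_filter_le hk'.2 hk (Ne.symm hk'.1) hne)
    (hE.card_filter_le hk hk'.2 hne (Ne.symm hk'.1))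

/-! ### Self-avoiding paths -/

/-- Starting with the half-edge `h`, there is a path of `r` edges that visits distinct vertices
of `U` and can be left again from its endpoint. -/
def Reaches (σ : Pairing d) : ℕ → HalfEdge d → Finset (Fin n) → Prop
  | 0, _, _ => True
  | r + 1, h, U => (σ.1 h).1 ∈ U ∧
      ∃ g : HalfEdge d, g.1 = (σ.1 h).1 ∧ g ≠ σ.1 h ∧ Reaches σ r g (U.erase (σ.1 h).1)

/-- The recursive bound on the probability that a path of `r` edges through `U` exists. -/
noncomputable def reachBound (d : Fin n → ℕ) (N : ℝ) (U : Finset (Fin n)) : ℕ → ℝ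
  | 0 => 1
  | r + 1 => (∑ v ∈ U, (d v : ℝ) * min 1 (((d v : ℝ) - 1) * reachBound d N U r)) / N

lemma mul_min_one_nonneg (k : ℕ) {q : ℝ} (hq : 0 ≤ q) :
    0 ≤ (k : ℝ) * min 1 (((k : ℝ) - 1) * q) := by
  rcases Nat.eq_zero_or_pos k with rfl | hk
  · simp
  · have : (1 : ℝ) ≤ k := by exact_mod_cast hk
    have : 0 ≤ ((k : ℝ) - 1) * q := mul_nonneg (by linarith) hq
    positivity

lemma reachBound_nonneg {N : ℝ} (hN : 0 < N) (U : Finset (Fin n)) :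
    ∀ r, 0 ≤ reachBound d N U r
  | 0 => zero_le_one
  | r + 1 => div_nonneg
      (Finset.sum_nonneg fun v _ => mul_min_one_nonneg (d v) (reachBound_nonneg hN U r)) hN.le

lemma card_halfEdge_erase (k : HalfEdge d) :
    (((Finset.univ.filter fun g : HalfEdge d => g.1 = k.1).erase k).card : ℝ)
      = (d k.1 : ℝ) - 1 := by
  have hk : k ∈ Finset.univ.filter fun g : HalfEdge d => g.1 = k.1 := by simp
  have hcard : (Finset.univ.filter fun g : HalfEdge d => g.1 = k.1).card = d k.1 := by
    rw [Finset.card_filter, Fintype.sum_sigma, Finset.sum_eq_single k.1] <;> simp +contextual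
  have hpos : 0 < d k.1 := by rw [← hcard]; exact Finset.card_pos.2 ⟨k, hk⟩
  rw [Finset.card_erase_of_mem hk, hcard, Nat.cast_sub hpos, Nat.cast_one]

-- Induction on the number of steps, each conditioning on the partner of the current half-edge and
-- so adding at most two half-edges to `X`. The hypothesis on `N` is what the last reveal needs:
-- with one step left it says that at least `N` candidates remain. The bound uses the fixed set
-- `U₀`, while `U` shrinks along the path, so that it does not depend on the history.
open Classical in
theorem card_filter_reaches_le {N : ℝ} (hN : 0 < N) {U₀ : Finset (Fin n)} (r : ℕ) :
    ∀ {E : Finset (Pairing d)} {X : Finset (HalfEdge d)} {U : Finset (Fin n)} {h : HalfEdge d},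
      ConstrainedOn E X → h ∉ X → h.1 ∉ U → (∀ g : HalfEdge d, g.1 ∈ U → g ∉ X) → U ⊆ U₀ →
      N + 2 * r + X.card ≤ (Fintype.card (HalfEdge d) : ℝ) + 1 →
      ((E.filter fun σ => Reaches σ r h U).card : ℝ) ≤ reachBound d N U₀ r * E.card := by
  induction r with
  | zero =>
    intro E X U h _ _ _ _ _ _
    rw [reachBound, one_mul]
    exact_mod_cast Finset.card_filter_le _ _
  | succ r ih =>
    intro E X U h hE hh hhU hUX hU hcard
    push_cast at hcard
    set q := reachBound d N U₀ r with hq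
    have hq0 : 0 ≤ q := reachBound_nonneg hN U₀ r
    set B : Finset (HalfEdge d) := Finset.univ.filter fun k => k.1 ∈ U
    set F : HalfEdge d → Finset (Pairing d) := fun k => E.filter fun σ => σ.1 h = k
    have hNX : N ≤ ((Fintype.card (HalfEdge d) - (X.card + 1) : ℕ) : ℝ) := by
      rw [Nat.cast_sub]
      · push_cast
        have : (0 : ℝ) ≤ r := Nat.cast_nonneg r
        linarith
      · have : (0 : ℝ) ≤ r := Nat.cast_nonneg r
        have h1 : ((X.card + 1 : ℕ) : ℝ) ≤ (Fintype.card (HalfEdge d) : ℝ) := by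
          push_cast; linarith
        exact_mod_cast h1
    have hF : ∀ k ∈ B, ((F k).card : ℝ) ≤ E.card / N := by
      intro k hk
      have hkU : k.1 ∈ U := (Finset.mem_filter.1 hk).2
      have := hE.card_filter_mul hh (hUX k hkU) (fun e => hhU (e ▸ hkU))
      rw [le_div_iff₀ hN]
      calc ((F k).card : ℝ) * N
          ≤ (F k).card * ((Fintype.card (HalfEdge d) - (X.card + 1) : ℕ) : ℝ) := by gcongr
        _ = E.card := by exact_mod_cast this
    have hstep : ∀ k ∈ B, (((F k).filter fun σ => Reaches σ (r + 1) h U).card : ℝ)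
        ≤ min 1 (((d k.1 : ℝ) - 1) * q) * (F k).card := by
      intro k hk
      have hkU : k.1 ∈ U := (Finset.mem_filter.1 hk).2
      rw [min_mul_of_nonneg _ _ (Nat.cast_nonneg _)]
      -- Given the entry half-edge `k`, either bound the probability by 1 or use a union bound over
      -- the other half-edges at its vertex.
      refine le_min ?_ ?_
      · rw [one_mul]
        exact_mod_cast Finset.card_filter_le _ _
      · have hsub : ((F k).filter fun σ => Reaches σ (r + 1) h U) ⊆
            ((Finset.univ.filter fun g : HalfEdge d => g.1 = k.1).erase k).biUnion
              fun g => (F k).filter fun σ => Reaches σ r g (U.erase k.1) := by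
          intro σ hσ
          obtain ⟨hσF, -, g, hg, hgk, hr⟩ := Finset.mem_filter.1 hσ
          have hσk : σ.1 h = k := (Finset.mem_filter.1 hσF).2
          rw [hσk] at hg hgk hr
          simp only [Finset.mem_biUnion]
          exact ⟨g, Finset.mem_erase.2 ⟨hgk, by simp [hg]⟩, Finset.mem_filter.2 ⟨hσF, hr⟩⟩
        have hbound : ∀ g ∈ (Finset.univ.filter fun g : HalfEdge d => g.1 = k.1).erase k,
            (((F k).filter fun σ => Reaches σ r g (U.erase k.1)).card : ℝ)
              ≤ q * (F k).card := by
          intro g hg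
          obtain ⟨hgk, hg⟩ := Finset.mem_erase.1 hg
          have hg1 : g.1 = k.1 := (Finset.mem_filter.1 hg).2
          have hhk : h.1 ≠ k.1 := fun e => hhU (e ▸ hkU)
          refine ih (X := insert h (insert k X)) (hE.filter h k) ?_ ?_ ?_ ?_ ?_
          · simp only [Finset.mem_insert, not_or]
            exact ⟨fun e => hhk (e ▸ hg1), hgk, hUX g (hg1 ▸ hkU)⟩
          · simp [hg1]
          · intro g' hg'
            obtain ⟨hne, hg'U⟩ := Finset.mem_erase.1 hg'
            simp only [Finset.mem_insert, not_or]
            exact ⟨fun e => hhU (e ▸ hg'U), fun e => hne (e ▸ rfl), hUX g' hg'U⟩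
          · exact (Finset.erase_subset _ _).trans hU
          · have h1 : (insert h (insert k X)).card ≤ X.card + 2 :=
              (Finset.card_insert_le _ _).trans (Nat.succ_le_succ (Finset.card_insert_le _ _))
            have h2 : ((insert h (insert k X)).card : ℝ) ≤ X.card + 2 := by exact_mod_cast h1
            linarith
        calc (((F k).filter fun σ => Reaches σ (r + 1) h U).card : ℝ)
            ≤ ∑ g ∈ (Finset.univ.filter fun g : HalfEdge d => g.1 = k.1).erase k,
              (((F k).filter fun σ => Reaches σ r g (U.erase k.1)).card : ℝ) := by
                exact_mod_cast (Finset.card_le_card hsub).trans Finset.card_biUnion_le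
          _ ≤ _ := Finset.sum_le_card_nsmul _ _ _ hbound
          _ = ((d k.1 : ℝ) - 1) * q * (F k).card := by
                rw [nsmul_eq_mul, card_halfEdge_erase, mul_assoc]
    have hsub : (E.filter fun σ => Reaches σ (r + 1) h U) ⊆
        B.biUnion fun k => (F k).filter fun σ => Reaches σ (r + 1) h U := by
      intro σ hσ
      obtain ⟨hσE, hr⟩ := Finset.mem_filter.1 hσ
      simp only [Finset.mem_biUnion]
      exact ⟨σ.1 h, Finset.mem_filter.2 ⟨Finset.mem_univ _, hr.1⟩,
        Finset.mem_filter.2 ⟨Finset.mem_filter.2 ⟨hσE, rfl⟩, hr⟩⟩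
    have hmin : ∀ k : HalfEdge d, 0 ≤ min 1 (((d k.1 : ℝ) - 1) * q) := by
      intro k
      have : (1 : ℝ) ≤ d k.1 := by exact_mod_cast (Fin.pos k.2)
      exact le_min zero_le_one (mul_nonneg (by linarith) hq0)
    calc ((E.filter fun σ => Reaches σ (r + 1) h U).card : ℝ)
        ≤ ∑ k ∈ B, (((F k).filter fun σ => Reaches σ (r + 1) h U).card : ℝ) := by
          exact_mod_cast (Finset.card_le_card hsub).trans Finset.card_biUnion_le
      _ ≤ ∑ k ∈ B, min 1 (((d k.1 : ℝ) - 1) * q) * (E.card / N) :=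
          Finset.sum_le_sum fun k hk => (hstep k hk).trans
            (mul_le_mul_of_nonneg_left (hF k hk) (hmin k))
      _ = (∑ v ∈ U, (d v : ℝ) * min 1 (((d v : ℝ) - 1) * q)) * (E.card / N) := by
          rw [← Finset.sum_mul]
          congr 1
          rw [Finset.sum_filter, Fintype.sum_sigma, ← Finset.sum_filter_add_sum_filter_not
            Finset.univ (fun v => v ∈ U)]
          rw [Finset.sum_eq_zero (s := Finset.univ.filter fun v => ¬ v ∈ U)]
          · rw [add_zero, Finset.filter_mem_eq_inter, Finset.univ_inter]
            refine Finset.sum_congr rfl fun v hv => ?_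
            simp [hv]
          · intro v hv
            simp [(Finset.mem_filter.1 hv).2]
      _ ≤ (∑ v ∈ U₀, (d v : ℝ) * min 1 (((d v : ℝ) - 1) * q)) * (E.card / N) := by
          refine mul_le_mul_of_nonneg_right (Finset.sum_le_sum_of_subset_of_nonneg hU
            fun v _ _ => mul_min_one_nonneg (d v) hq0) (by positivity)
      _ = reachBound d N U₀ (r + 1) * E.card := by
          rw [reachBound, ← hq]
          ring

/-! ### Diameters and paths -/

/-- The path has one edge more than `r` because its last edge provides the exit from the endpoint.
The membership of the first new vertex in `U` is carried along for the induction: it shows that each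
exit differs from the entry. -/
lemma exists_reaches_of_isPath (σ : Pairing d) (r : ℕ) :
    ∀ {u w : Fin n} {U : Finset (Fin n)} (p : (configGraph σ).Walk u w), p.IsPath → u ∉ U →
      (∀ x ∈ p.support, x ≠ u → x ∈ U) → r + 1 ≤ p.length →
      ∃ h : HalfEdge d, h.1 = u ∧ (σ.1 h).1 ∈ U ∧ Reaches σ r h U := by
  induction r with
  | zero =>
    intro u w U p hp huU hsupp hlen
    cases p with
    | nil => simp at hlen
    | @cons _ v _ hadj p =>
      have hadj' := hadj
      obtain ⟨hne, h, hu, hv⟩ := hadj'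
      refine ⟨h, hu, ?_, trivial⟩
      rw [hv]
      exact hsupp v (by simp) hne.symm
  | succ r ih =>
    intro u w U p hp huU hsupp hlen
    cases p with
    | nil => simp at hlen
    | @cons _ v _ hadj p =>
      rw [SimpleGraph.Walk.cons_isPath_iff] at hp
      have hadj' := hadj
      obtain ⟨hne, h, hu, hv⟩ := hadj'
      have hvU : v ∈ U := hsupp v (by simp) hne.symm
      obtain ⟨g, hg, hgU, hr⟩ := ih (U := U.erase v) p hp.1 (by simp) (fun x hx hxv =>
        Finset.mem_erase.2 ⟨hxv, hsupp x (by simp [hx]) (fun e => hp.2 (e ▸ hx))⟩)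
        (by simpa using hlen)
      refine ⟨h, hu, hv ▸ hvU, hv ▸ hvU, g, hg.trans hv.symm, ?_, hv.symm ▸ hr⟩
      -- Leaving through the entry half-edge would lead back to `u`, which is not in `U`.
      rintro rfl
      rw [σ.2.1, hu] at hgU
      exact huU (Finset.mem_of_mem_erase hgU)

lemma exists_diam_eq_maxComponentDiam {V : Type} [Finite V] (G : SimpleGraph V)
    (hG : 0 < maxComponentDiam G) :
    ∃ C : G.ConnectedComponent, C.toSimpleGraph.diam = maxComponentDiam G := by
  rcases isEmpty_or_nonempty G.ConnectedComponent with h | h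
  · simp [maxComponentDiam] at hG
  · exact exists_eq_ciSup_of_finite

/-- Take the vertex of smallest index in a component of maximal diameter. By the triangle inequality
one end of a diametral pair is at least half the diameter away from it, and a geodesic to that end
is a path through larger indices. -/
theorem exists_reaches_of_le_maxComponentDiam (σ : Pairing d) (K L : ℕ)
    (hL : 2 * (L + 1) ≤ maxComponentDiam (removeHubs K (configGraph σ))) :
    ∃ i : Fin n, K < (i : ℕ) + 1 ∧ ∃ h : HalfEdge d, h.1 = i ∧
      Reaches σ L h (Finset.univ.filter fun v => i < v) := by
  obtain ⟨C, hC⟩ := exists_diam_eq_maxComponentDiam _ (lt_of_lt_of_le (by omega) hL)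
  have hconn := C.connected_toSimpleGraph
  have := hconn.nonempty
  let f : C.toSimpleGraph →g configGraph σ :=
    ⟨fun x => x.1.1, fun {a b} hab => hab⟩
  have hf : Function.Injective f := fun a b hab => Subtype.ext (Subtype.ext hab)
  obtain ⟨m, hm⟩ := Finite.exists_min (fun x => f x)
  obtain ⟨u, v, huv⟩ := C.toSimpleGraph.exists_dist_eq_diam
  have htri := hconn.dist_triangle (u := u) (v := m) (w := v)
  have hex : ∃ w, L + 1 ≤ C.toSimpleGraph.dist m w := by
    by_contra! hcon
    have h1 := hcon u
    have h2 := hcon v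
    rw [SimpleGraph.dist_comm] at h1
    omega
  obtain ⟨w, hw⟩ := hex
  obtain ⟨p, hp, hlen⟩ := (hconn.preconnected m w).exists_path_of_dist
  obtain ⟨h, hh, -, hr⟩ := exists_reaches_of_isPath σ L
    (U := Finset.univ.filter fun v => f m < v) (p.map f)
    (hp.map hf) (by simp) (by
      intro x hx hne
      rw [SimpleGraph.Walk.support_map, List.mem_map] at hx
      obtain ⟨y, -, rfl⟩ := hx
      simpa using lt_of_le_of_ne (hm y) hne.symm)
    (by rw [SimpleGraph.Walk.length_map, hlen]; exact hw)
  exact ⟨f m, m.1.2, h, hh, hr⟩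

/-- The union bound over the vertices from which a long path starts. -/
theorem configLaw_real_maxComponentDiam_le (K L : ℕ) {N : ℝ} (hN : 0 < N)
    (hcard : N + 2 * L ≤ (totalDegree d : ℝ) + 1) (S : Set (Pairing d))
    (hS : ∀ σ ∈ S, 2 * (L + 1) ≤ maxComponentDiam (removeHubs K (configGraph σ))) :
    (configLaw d).real S ≤ ∑ i ∈ Finset.univ.filter (fun i : Fin n => K < (i : ℕ) + 1),
      (d i : ℝ) * reachBound d N (Finset.univ.filter fun v => i < v) L := by
  classical
  set I := Finset.univ.filter (fun i : Fin n => K < (i : ℕ) + 1)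
  have hHcard : Fintype.card (HalfEdge d) = totalDegree d := by simp [totalDegree]
  set B := ∑ i ∈ I, (d i : ℝ) * reachBound d N (Finset.univ.filter fun v => i < v) L
  have hB0 : 0 ≤ B := Finset.sum_nonneg fun i _ =>
    mul_nonneg (Nat.cast_nonneg _) (reachBound_nonneg hN _ _)
  have hsub : S.toFinset ⊆ (I.sigma fun i => (Finset.univ : Finset (Fin (d i)))).biUnion
      fun h => (Finset.univ : Finset (Pairing d)).filter fun σ =>
        Reaches σ L h (Finset.univ.filter fun v => h.1 < v) := by
    intro σ hσ
    obtain ⟨i, hi, h, rfl, hr⟩ := exists_reaches_of_le_maxComponentDiam σ K L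
      (hS σ (Set.mem_toFinset.1 hσ))
    simp only [Finset.mem_biUnion]
    exact ⟨h, Finset.mem_sigma.2 ⟨by simpa [I] using hi, Finset.mem_univ _⟩,
      Finset.mem_filter.2 ⟨Finset.mem_univ _, hr⟩⟩
  have hcount : (S.toFinset.card : ℝ) ≤ B * Fintype.card (Pairing d) := by
    calc (S.toFinset.card : ℝ) ≤ ∑ h ∈ I.sigma fun i => (Finset.univ : Finset (Fin (d i))),
          (((Finset.univ : Finset (Pairing d)).filter fun σ =>
            Reaches σ L h (Finset.univ.filter fun v => h.1 < v)).card : ℝ) := by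
          exact_mod_cast (Finset.card_le_card hsub).trans Finset.card_biUnion_le
      _ ≤ ∑ h ∈ I.sigma fun i => (Finset.univ : Finset (Fin (d i))),
          reachBound d N (Finset.univ.filter fun v => h.1 < v) L *
            (Finset.univ : Finset (Pairing d)).card := by
          refine Finset.sum_le_sum fun h _ => card_filter_reaches_le hN L constrainedOn_univ
            (by simp) (by simp) (by simp) subset_rfl ?_
          rw [hHcard]
          simpa using hcard
      _ = B * Fintype.card (Pairing d) := by
          rw [← Finset.sum_mul, Finset.sum_sigma, Finset.card_univ]
          simp [B]
  rw [MeasureTheory.measureReal_def, configLaw, ProbabilityTheory.uniformOn_univ,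
    ENNReal.toReal_div, ENNReal.toReal_natCast]
  have : MeasureTheory.Measure.count S = (S.toFinset.card : ENNReal) := by
    rw [← MeasureTheory.Measure.count_apply_finset' (MeasurableSpace.measurableSet_top)]
    simp
  rw [this, ENNReal.toReal_natCast]
  exact div_le_of_le_mul₀ (Nat.cast_nonneg _) hB0 hcount

end Matching

end CritCM

namespace CritCM

/-! ### Decay of the recursive bound -/

section Decay

/-- A sequence that loses at least `c * q ^ (1 + s)` in each step, as long as it exceeds `a`, is
below `a` after `O(a ^ (-s))` steps. -/
lemma le_of_sub_rpow_step {s c a : ℝ} (hs : 0 < s) (hs1 : s ≤ 1) (hc : 0 < c) (ha : 0 < a)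
    {q : ℕ → ℝ} (hanti : ∀ r, q (r + 1) ≤ q r)
    (hstep : ∀ r, a ≤ q r → q (r + 1) ≤ q r * (1 - c * q r ^ s)) {m : ℕ}
    (hm : 1 ≤ a ^ s * (s * c * m)) : q m ≤ a := by
  by_contra! hcon
  have hq : ∀ r ≤ m, a < q r := fun r hr => hcon.trans_le (antitone_nat_of_succ_le hanti hr)
  -- Discrete form of the equation `q' = -c q^(1+s)`: the quantity `q^(-s)` grows by at least `s *
  -- c` per step.
  have hgrow : ∀ r ≤ m, s * c * r ≤ (q r ^ s)⁻¹ := by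
    intro r
    induction r with
    | zero =>
      intro h0
      have := (ha.trans (hq 0 h0)).le
      simpa using Real.rpow_nonneg this s
    | succ r ih =>
      intro hr
      have h1 := ih (by omega)
      have hq0 : 0 < q r := ha.trans (hq r (by omega))
      have hq1 : 0 < q (r + 1) := ha.trans (hq _ hr)
      have hst := hstep r (hq r (by omega)).le
      set z := q r ^ s with hz
      have hz0 : 0 < z := Real.rpow_pos_of_pos hq0 s
      have hcz : 0 < 1 - c * z := by
        by_contra! h
        exact absurd (hq1.trans_le hst) (not_lt.2 (mul_nonpos_of_nonneg_of_nonpos hq0.le h))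
      have h2 : q (r + 1) ^ s ≤ z * (1 - s * (c * z)) := by
        calc q (r + 1) ^ s ≤ (q r * (1 - c * z)) ^ s := Real.rpow_le_rpow hq1.le hst hs.le
          _ = z * (1 - c * z) ^ s := Real.mul_rpow hq0.le hcz.le
          _ ≤ z * (1 - s * (c * z)) := by
            have := rpow_one_add_le_one_add_mul_self (s := -(c * z)) (by linarith) hs.le hs1
            have h3 : (1 - c * z) ^ s ≤ 1 - s * (c * z) := by
              rw [sub_eq_add_neg]; linarith
            exact mul_le_mul_of_nonneg_left h3 hz0.le
      have hz1 : 0 < q (r + 1) ^ s := Real.rpow_pos_of_pos hq1 s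
      have h4 : z⁻¹ + s * c ≤ (q (r + 1) ^ s)⁻¹ := by
        rw [le_inv_comm₀ (by positivity) hz1]
        refine h2.trans ?_
        have : z⁻¹ + s * c = (1 + s * (c * z)) / z := by field_simp
        rw [this, inv_div, le_div_iff₀ (by positivity)]
        -- This is `(1 - t) * (1 + t) ≤ 1` with `t = s * (c * z)`.
        nlinarith [mul_pos hz0 hz0, sq_nonneg (s * (c * z))]
      push_cast
      linarith
  have hz0 : 0 < q m ^ s := Real.rpow_pos_of_pos (ha.trans hcon) s
  have h1 := hgrow m le_rfl
  have hlt : a ^ s < q m ^ s := Real.rpow_lt_rpow ha.le hcon hs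
  have hpos : 0 < s * c * m := by
    by_contra! h
    have := mul_nonpos_of_nonneg_of_nonpos (Real.rpow_nonneg ha.le s) h
    linarith
  have h2 : q m ^ s * (s * c * m) ≤ 1 := by
    calc q m ^ s * (s * c * m) ≤ q m ^ s * (q m ^ s)⁻¹ := by gcongr
      _ = 1 := mul_inv_cancel₀ hz0.ne'
  nlinarith

variable {n : ℕ} {d : Fin n → ℕ}

lemma mul_sub_one_nonneg (k : ℕ) : (0 : ℝ) ≤ (k : ℝ) * ((k : ℝ) - 1) := by
  rcases Nat.eq_zero_or_pos k with rfl | hk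
  · simp
  · have : (1 : ℝ) ≤ k := by exact_mod_cast hk
    exact mul_nonneg (by linarith) (by linarith)

lemma reachBound_succ_le {N : ℝ} (hN : 0 < N) (U : Finset (Fin n)) (r : ℕ) :
    reachBound d N U (r + 1) ≤
      (∑ v ∈ U, (d v : ℝ) * ((d v : ℝ) - 1)) / N * reachBound d N U r := by
  rw [reachBound, div_mul_eq_mul_div, Finset.sum_mul]
  refine div_le_div_of_nonneg_right (Finset.sum_le_sum fun v _ => ?_) hN.le
  rw [mul_assoc]
  exact mul_le_mul_of_nonneg_left (min_le_right _ _) (Nat.cast_nonneg _)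

/-- A vertex with `(d v - 1) * q ≥ 2` loses at least `d v` through the truncation at 1. The total
loss is thus at least the size-biased tail at a level of order `1 / q`. -/
lemma sum_mul_min_le {τ c₀ N q : ℝ} (hτ : 3 < τ) (hc₀ : 0 < c₀) {D : ℕ}
    (htail : ∀ l : ℕ, 1 ≤ l → l ≤ D → c₀ / (l : ℝ) ^ (τ - 2) ≤ sizeBiasedTail d l)
    (hN : 0 < N) (hNd : N ≤ totalDegree d) (hq : 0 < q) (hq1 : q ≤ 1) (hD : 4 / q ≤ D) :
    (∑ v, (d v : ℝ) * min 1 (((d v : ℝ) - 1) * q)) / N ≤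
      (∑ v, (d v : ℝ) * ((d v : ℝ) - 1)) / N * q - c₀ * (q / 4) ^ (τ - 2) := by
  -- The level satisfies `l - 1 ≥ 2 / q`, and `l ≤ 4 / q` because `q ≤ 1`.
  set l : ℕ := ⌈2 / q⌉₊ + 1 with hl
  have hq2 : 2 / q ≤ ⌈2 / q⌉₊ := Nat.le_ceil _
  have hl4 : (l : ℝ) ≤ 4 / q := by
    have h1 := Nat.ceil_lt_add_one (a := 2 / q) (by positivity)
    have h2 : 2 ≤ 2 / q := by rw [le_div_iff₀ hq]; linarith
    have h3 : 4 / q = 2 / q + 2 / q := by ring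
    rw [hl]; push_cast; linarith
  have hlD : l ≤ D := by exact_mod_cast hl4.trans hD
  have hl0 : (0 : ℝ) < l := by positivity
  have htl := htail l (by omega) hlD
  have hpt : ∀ v, (d v : ℝ) * min 1 (((d v : ℝ) - 1) * q) + (if l ≤ d v then (d v : ℝ) else 0) ≤
      (d v : ℝ) * ((d v : ℝ) - 1) * q := by
    intro v
    have hd0 : (0 : ℝ) ≤ d v := Nat.cast_nonneg _
    split_ifs with hv
    · have h1 : (l : ℝ) ≤ d v := by exact_mod_cast hv
      have h2 : 2 / q ≤ (d v : ℝ) - 1 := by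
        rw [hl] at h1; push_cast at h1; linarith
      have h3 : 2 ≤ ((d v : ℝ) - 1) * q := (div_le_iff₀ hq).1 h2
      have h4 : min 1 (((d v : ℝ) - 1) * q) ≤ 1 := min_le_left _ _
      nlinarith
    · rw [add_zero, mul_assoc]
      exact mul_le_mul_of_nonneg_left (min_le_right _ _) hd0
  have hsum := Finset.sum_le_sum fun v (_ : v ∈ Finset.univ) => hpt v
  rw [Finset.sum_add_distrib, ← Finset.sum_mul, ← Finset.sum_filter] at hsum
  have hT : (0 : ℝ) < totalDegree d := hN.trans_le hNd
  have htaileq : (∑ v ∈ Finset.univ.filter (fun v => l ≤ d v), (d v : ℝ)) =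
      sizeBiasedTail d l * totalDegree d := by
    rw [sizeBiasedTail, ← Finset.sum_div, div_mul_cancel₀ _ hT.ne']
  have hc : c₀ * (q / 4) ^ (τ - 2) ≤ sizeBiasedTail d l := by
    refine le_trans ?_ htl
    rw [div_eq_mul_inv c₀, ← Real.inv_rpow hl0.le]
    gcongr
    · linarith
    · rw [le_inv_comm₀ (by positivity) hl0, inv_div]
      exact hl4
  rw [htaileq] at hsum
  rw [div_le_iff₀ hN, sub_mul]
  have h5 : c₀ * (q / 4) ^ (τ - 2) * N ≤ sizeBiasedTail d l * totalDegree d := by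
    have : 0 ≤ sizeBiasedTail d l := le_trans (by positivity) hc
    gcongr
  have h6 : (∑ v, (d v : ℝ) * ((d v : ℝ) - 1)) / N * q * N =
      (∑ v, (d v : ℝ) * ((d v : ℝ) - 1)) * q := by field_simp
  rw [h6]
  linarith

/-- Over the first `m` steps the offspring tail brings the bound down to `a`, over the next `k`
steps the mean offspring reduces it further. -/
theorem reachBound_add_le {τ c₀ N a b ρ : ℝ} (hτ₃ : 3 < τ) (hτ₄ : τ < 4) (hc₀ : 0 < c₀) {D : ℕ}
    (htail : ∀ l : ℕ, 1 ≤ l → l ≤ D → c₀ / (l : ℝ) ^ (τ - 2) ≤ sizeBiasedTail d l)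
    (hN : 0 < N) (hNd : N ≤ totalDegree d) (U : Finset (Fin n))
    (hall : (∑ v, (d v : ℝ) * ((d v : ℝ) - 1)) / N ≤ 1 + b)
    (hU : (∑ v ∈ U, (d v : ℝ) * ((d v : ℝ) - 1)) / N ≤ ρ) (hρ : ρ ≤ 1)
    (ha : 0 < a) (hD : 4 / a ≤ D)
    (hb : b ≤ c₀ / 4 ^ (τ - 2) / 2 * a ^ (τ - 3)) {m k : ℕ}
    (hm : 1 ≤ a ^ (τ - 3) * ((τ - 3) * (c₀ / 4 ^ (τ - 2) / 2) * m)) :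
    reachBound d N U (m + k) ≤ ρ ^ k * a := by
  set q := reachBound d N U with hq
  set c := c₀ / 4 ^ (τ - 2) with hc
  have hc0 : 0 < c := by positivity
  have hq0 : ∀ r, 0 ≤ q r := reachBound_nonneg hN U
  have hstep : ∀ r, q (r + 1) ≤ ρ * q r := fun r =>
    (reachBound_succ_le hN U r).trans (mul_le_mul_of_nonneg_right hU (hq0 r))
  have hanti : ∀ r, q (r + 1) ≤ q r := fun r =>
    (hstep r).trans (mul_le_of_le_one_left (hq0 r) hρ)
  have hρ0 : 0 ≤ ρ :=
    (div_nonneg (Finset.sum_nonneg fun v _ => mul_sub_one_nonneg (d v)) hN.le).trans hU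
  have hmle : q m ≤ a := by
    refine le_of_sub_rpow_step (by linarith) (by linarith) (half_pos hc0) ha hanti ?_ hm
    intro r hr
    have hqr : 0 < q r := ha.trans_le hr
    have hq1 : q r ≤ 1 := antitone_nat_of_succ_le hanti (Nat.zero_le r)
    have h1 := sum_mul_min_le hτ₃ hc₀ htail hN hNd hqr hq1
      (le_trans (by gcongr) hD)
    -- The tail hypothesis concerns all vertices, so in this phase the sum over `U` is enlarged to
    -- all of them.
    have h2 : q (r + 1) ≤ (∑ v, (d v : ℝ) * min 1 (((d v : ℝ) - 1) * q r)) / N := by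
      rw [hq, reachBound]
      exact div_le_div_of_nonneg_right (Finset.sum_le_sum_of_subset_of_nonneg
        (Finset.subset_univ U) fun v _ _ => mul_min_one_nonneg (d v) hqr.le) hN.le
    have h3 : c₀ * (q r / 4) ^ (τ - 2) = c * (q r * q r ^ (τ - 3)) := by
      rw [Real.div_rpow hqr.le (by norm_num), hc,
        show τ - 2 = 1 + (τ - 3) by ring, Real.rpow_add hqr, Real.rpow_one]
      ring
    -- As long as `q r ≥ a`, half of the truncation loss absorbs the excess `b` of the mean over 1.
    have h4 : b ≤ c / 2 * q r ^ (τ - 3) := hb.trans (by gcongr)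
    have h5 : (∑ v, (d v : ℝ) * ((d v : ℝ) - 1)) / N * q r ≤ (1 + b) * q r := by gcongr
    have h6 : b * q r ≤ c / 2 * q r ^ (τ - 3) * q r := by gcongr
    rw [h3] at h1
    linarith
  have hk : ∀ k, q (m + k) ≤ ρ ^ k * a := by
    intro k
    induction k with
    | zero => simpa using hmle
    | succ k ih =>
      calc q (m + (k + 1)) ≤ ρ * q (m + k) := hstep (m + k)
        _ ≤ ρ * (ρ ^ k * a) := by gcongr
        _ = ρ ^ (k + 1) * a := by ring
  exact hk k

/-- Removing the first `j` vertices lowers the second factorial moment. -/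
lemma sum_filter_mul_sub_one_le (d : Fin n → ℕ) (j : ℕ) :
    ∑ v ∈ Finset.univ.filter (fun v : Fin n => j ≤ v), (d v : ℝ) * ((d v : ℝ) - 1) ≤
      ∑ v, (d v : ℝ) * ((d v : ℝ) - 1) -
        ((∑ v ∈ Finset.univ.filter (fun v : Fin n => (v : ℕ) + 1 < j + 1), (d v : ℝ) ^ 2) / 2
          - j / 2) := by
  rw [← Finset.sum_filter_add_sum_filter_not Finset.univ (fun v : Fin n => j ≤ v)
    (fun v => (d v : ℝ) * ((d v : ℝ) - 1))]
  have hcard : ((Finset.univ.filter (fun v : Fin n => (v : ℕ) + 1 < j + 1)).card : ℝ) ≤ j := by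
    have : (Finset.univ.filter (fun v : Fin n => (v : ℕ) + 1 < j + 1)).card ≤
        (Finset.range j).card :=
      Finset.card_le_card_of_injOn (fun v => (v : ℕ)) (fun v hv => by simpa using hv)
        (fun a _ b _ h => Fin.ext h)
    rw [Finset.card_range] at this
    exact_mod_cast this
  have hfilter : Finset.univ.filter (fun v : Fin n => ¬ j ≤ v) =
      Finset.univ.filter (fun v : Fin n => (v : ℕ) + 1 < j + 1) := by
    ext v; simp
  have hsum : ∑ v ∈ Finset.univ.filter (fun v : Fin n => (v : ℕ) + 1 < j + 1),
      ((d v : ℝ) ^ 2 / 2 - 1 / 2) ≤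
      ∑ v ∈ Finset.univ.filter (fun v : Fin n => (v : ℕ) + 1 < j + 1),
        (d v : ℝ) * ((d v : ℝ) - 1) :=
    -- Pointwise, `d(d-1) - (d²-1)/2 = (d-1)²/2`.
    Finset.sum_le_sum fun v _ => by nlinarith [sq_nonneg ((d v : ℝ) - 1)]
  rw [Finset.sum_sub_distrib, ← Finset.sum_div, Finset.sum_const, nsmul_eq_mul] at hsum
  rw [hfilter]
  linarith

end Decay

end CritCM

namespace CritCM

/-! ### Asymptotics -/

section Asymptotic

lemma alphaExp_pos {τ : ℝ} (hτ₃ : 3 < τ) : 0 < alphaExp τ :=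
  div_pos one_pos (by linarith)

lemma etaExp_pos {τ : ℝ} (hτ₃ : 3 < τ) : 0 < etaExp τ :=
  div_pos (by linarith) (by linarith)

lemma two_mul_alphaExp {τ : ℝ} (hτ₃ : 3 < τ) : 2 * alphaExp τ = 1 - etaExp τ := by
  have : τ - 1 ≠ 0 := by linarith
  rw [alphaExp, etaExp]; field_simp; ring

lemma alphaExp_mul {τ : ℝ} : alphaExp τ * (τ - 3) = etaExp τ := by
  rw [alphaExp, etaExp]; ring

lemma etaExp_lt_alphaExp {τ : ℝ} (hτ₃ : 3 < τ) (hτ₄ : τ < 4) : etaExp τ < alphaExp τ := by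
  rw [← alphaExp_mul]
  nlinarith [alphaExp_pos hτ₃]

lemma eventually_const_le_rpow {γ : ℝ} (hγ : 0 < γ) (C : ℝ) :
    ∀ᶠ n : ℕ in atTop, C ≤ (n : ℝ) ^ γ :=
  ((tendsto_rpow_atTop hγ).comp tendsto_natCast_atTop_atTop).eventually_ge_atTop C

variable {τ lam : ℝ} {θ : ℕ → ℝ} {d : (n : ℕ) → Fin n → ℕ}

lemma degreeCount_one_le {n : ℕ} (d : Fin n → ℕ) : degreeCount d 1 ≤ totalDegree d := by
  rw [degreeCount, Finset.card_filter, totalDegree]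
  refine Finset.sum_le_sum fun i _ => ?_
  split_ifs with h
  · exact h.ge
  · exact Nat.zero_le _

/-- The vertices of degree one give the lower bound, the convergence of the mean degree the upper
one. -/
lemma GeneralAssumptions.totalDegree_bounds (h : GeneralAssumptions τ θ d) :
    ∃ c C : ℝ, 0 < c ∧ 0 < C ∧ ∀ᶠ n : ℕ in atTop,
      c * n ≤ totalDegree (d n) ∧ (totalDegree (d n) : ℝ) ≤ C * n := by
  obtain ⟨p, μ, μ₂, -, -, -, hμ, -⟩ := h.moments
  obtain ⟨b, hb, hb'⟩ := h.degreeOne.2.exists_pos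
  refine ⟨b⁻¹, |μ| + 1, by positivity, by positivity, ?_⟩
  filter_upwards [hb'.bound, hμ.eventually_le_const (show μ < |μ| + 1 by linarith [le_abs_self μ]),
    eventually_gt_atTop 0] with n h1 h2 hn
  have hn' : (0 : ℝ) < n := by exact_mod_cast hn
  constructor
  · rw [inv_mul_le_iff₀ hb]
    simp only [Real.norm_natCast] at h1
    refine h1.trans ?_
    gcongr
    exact degreeCount_one_le _
  · rw [one_div, inv_mul_le_iff₀ hn'] at h2
    rw [totalDegree]
    push_cast
    linarith

lemma Critical.eventually_nu_le (h : Critical τ lam d) :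
    ∀ᶠ n : ℕ in atTop, nu (d n) ≤ 1 + (|lam| + 1) * (n : ℝ) ^ (-etaExp τ) := by
  filter_upwards [h.bound one_pos] with n hn
  have h0 : (0 : ℝ) ≤ (n : ℝ) ^ (-etaExp τ) := Real.rpow_nonneg (Nat.cast_nonneg n) _
  rw [one_mul, Real.norm_of_nonneg h0] at hn
  have h1 := (Real.le_norm_self _).trans hn
  have h2 : lam * (n : ℝ) ^ (-etaExp τ) ≤ |lam| * (n : ℝ) ^ (-etaExp τ) := by
    gcongr; exact le_abs_self _
  linarith

lemma GeneralAssumptions.theta_nonneg (h : GeneralAssumptions τ θ d) (i : ℕ) : 0 ≤ θ i := by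
  refine ge_of_tendsto' (h.highDegree i) fun n => ?_
  split_ifs <;> positivity

lemma GeneralAssumptions.theta_zero_pos (h : GeneralAssumptions τ θ d) : 0 < θ 0 := by
  by_contra! hcon
  refine h.theta_sq ?_
  have : (fun i => θ i ^ 2) = fun _ => 0 := by
    ext i
    rw [le_antisymm ((h.theta_antitone (Nat.zero_le i)).trans hcon) (h.theta_nonneg i)]
    norm_num
  rw [this]
  exact summable_zero

/-- The tail assumption holds only up to the largest degree; this bound lets it be used down to `q`
of order `n^{-α}`. -/
lemma GeneralAssumptions.eventually_le_degree_zero (h : GeneralAssumptions τ θ d) :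
    ∀ᶠ n : ℕ in atTop, ∃ hn : 0 < n,
      θ 0 / 2 * (n : ℝ) ^ alphaExp τ ≤ (d n ⟨0, hn⟩ : ℝ) := by
  filter_upwards [(h.highDegree 0).eventually_const_le (half_lt_self h.theta_zero_pos),
    eventually_gt_atTop 0] with n h1 hn
  have hn' : (0 : ℝ) < n := by exact_mod_cast hn
  refine ⟨hn, ?_⟩
  rw [dif_pos hn, Real.rpow_neg hn'.le, inv_mul_eq_div, le_div_iff₀ (by positivity)] at h1
  exact h1

lemma GeneralAssumptions.tendsto_beta (h : GeneralAssumptions τ θ d) (j : ℕ) :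
    Tendsto (fun n : ℕ => beta τ (d n) (j + 1)) atTop
      (𝓝 (∑ i ∈ Finset.range j, θ i ^ 2)) := by
  refine (tendsto_finsetSum (Finset.range j)
    fun i _ => (h.highDegree i).pow 2).congr' ?_
  filter_upwards [eventually_ge_atTop j] with n hn
  rw [beta, Finset.mul_sum]
  symm
  refine Finset.sum_bij (fun v _ => (v : ℕ)) (fun v hv => by simpa using hv)
    (fun a _ b _ hab => Fin.ext hab) (fun i hi => ?_) (fun v hv => ?_)
  · have hi := Finset.mem_range.1 hi
    exact ⟨⟨i, by omega⟩, by simpa using hi, rfl⟩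
  · rw [dif_pos v.2, mul_pow, ← Real.rpow_natCast ((n : ℝ) ^ (-alphaExp τ)),
      ← Real.rpow_mul (Nat.cast_nonneg n)]
    congr 2
    push_cast; ring

lemma beta_mono (τ : ℝ) {n : ℕ} (d : Fin n → ℕ) : Monotone (beta τ d) := by
  intro i j hij
  rw [beta, beta]
  refine mul_le_mul_of_nonneg_left (Finset.sum_le_sum_of_subset_of_nonneg (fun v hv => ?_)
    fun _ _ _ => by positivity) (by positivity)
  simp only [Finset.mem_filter, Finset.mem_univ, true_and] at hv ⊢
  omega

/-- The sum of `θ i ^ 2` diverges, and monotonicity of `beta` in the index makes the bound uniform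
in `j`. -/
lemma GeneralAssumptions.exists_eventually_le_beta (h : GeneralAssumptions τ θ d) (B : ℝ) :
    ∃ K : ℕ, ∀ᶠ n : ℕ in atTop, ∀ j, K ≤ j → B ≤ beta τ (d n) (j + 1) := by
  have h1 := (not_summable_iff_tendsto_nat_atTop_of_nonneg fun i => sq_nonneg (θ i)).1 h.theta_sq
  obtain ⟨K, hK⟩ := (h1.eventually_gt_atTop B).exists
  refine ⟨K, ?_⟩
  filter_upwards [(h.tendsto_beta K).eventually_const_le hK] with n hn j hj
  exact hn.trans (beta_mono τ (d n) (by omega))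

/-- The number of generations in each of the two phases. -/
noncomputable def phaseLength (τ ε : ℝ) (n : ℕ) : ℕ := ⌈ε * (n : ℝ) ^ etaExp τ / 8⌉₊

/-- The two phases use up `4m = O(n^η)` half-edges. As `2η < 1`, this is a fraction of the total
below `n^{-η}`, so the error stays within the critical window. -/
lemma GeneralAssumptions.eventually_freeHalfEdges (h : GeneralAssumptions τ θ d) (hτ₃ : 3 < τ)
    (hτ₄ : τ < 4) {ε : ℝ} (hε : 0 < ε) :
    ∀ᶠ n : ℕ in atTop, 0 < (totalDegree (d n) : ℝ) - 4 * phaseLength τ ε n ∧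
      (totalDegree (d n) : ℝ) ≤
        (1 + (n : ℝ) ^ (-etaExp τ)) * ((totalDegree (d n) : ℝ) - 4 * phaseLength τ ε n) := by
  obtain ⟨c, C, hc, -, hcC⟩ := h.totalDegree_bounds
  have hη := etaExp_pos hτ₃
  have hη2 : 0 < 1 - 2 * etaExp τ := by
    have := etaExp_lt_alphaExp hτ₃ hτ₄
    have := two_mul_alphaExp hτ₃
    linarith
  filter_upwards [hcC, eventually_const_le_rpow hη 1, eventually_const_le_rpow hη2 ((ε + 9) / c),
    eventually_gt_atTop 0] with n hn h1 h2 hn0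
  have hn' : (0 : ℝ) < n := by exact_mod_cast hn0
  set y := (n : ℝ) ^ etaExp τ with hy
  have hy0 : 0 < y := by positivity
  have hx : (n : ℝ) ^ (-etaExp τ) = y⁻¹ := Real.rpow_neg hn'.le _
  have hnn : (n : ℝ) ^ (1 - 2 * etaExp τ) * y = n * y⁻¹ := by
    rw [← hx, hy, ← Real.rpow_add hn', ← Real.rpow_one_add' hn'.le (by linarith)]
    congr 1; ring
  have hm : (phaseLength τ ε n : ℝ) ≤ ε * y / 8 + 1 :=
    (Nat.ceil_lt_add_one (by positivity)).le
  have h8 : 8 * (phaseLength τ ε n : ℝ) < c * n * y⁻¹ := by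
    calc 8 * (phaseLength τ ε n : ℝ) < (ε + 9) * y := by linarith
      _ ≤ c * ((n : ℝ) ^ (1 - 2 * etaExp τ) * y) := by
        rw [div_le_iff₀ hc] at h2
        nlinarith
      _ = c * n * y⁻¹ := by rw [hnn]; ring
  have hyi : y⁻¹ ≤ 1 := inv_le_one_of_one_le₀ h1
  have hyi0 : 0 < y⁻¹ := by positivity
  have h9 : c * n * y⁻¹ ≤ totalDegree (d n) * y⁻¹ := by gcongr; exact hn.1
  have hT : (0 : ℝ) ≤ totalDegree (d n) := Nat.cast_nonneg _
  have hm0 : (0 : ℝ) ≤ phaseLength τ ε n := Nat.cast_nonneg _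
  rw [hx]
  constructor
  · nlinarith
  · nlinarith

/-- The mean offspring after the removal of the first `j` vertices. -/
lemma sum_mul_sub_one_div_le {n : ℕ} {d : Fin n → ℕ} {N C₁ C₂ c₁ x b : ℝ} {j : ℕ}
    {U : Finset (Fin n)} (hUj : ∀ v ∈ U, j ≤ v)
    (hall : (∑ v, (d v : ℝ) * ((d v : ℝ) - 1)) / N ≤ 1 + C₂ * x)
    (hS : ∑ v ∈ Finset.univ.filter (fun v : Fin n => (v : ℕ) + 1 < j + 1), (d v : ℝ) ^ 2 =
      n * (x * b))
    (hjx : (j : ℝ) ≤ n * x) (hN : 0 < N) (hNn : N ≤ C₁ * n) (hnN : c₁ * n ≤ 2 * N)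
    (hc₁ : 0 < c₁) (hC₁ : 0 < C₁) (hx : 0 ≤ x) (hb : 0 ≤ b)
    (hbB : 4 * C₁ * (C₂ + 1 / c₁) ≤ b) :
    (∑ v ∈ U, (d v : ℝ) * ((d v : ℝ) - 1)) / N ≤ 1 - x * b / (4 * C₁) := by
  have h1 : ∑ v ∈ U, (d v : ℝ) * ((d v : ℝ) - 1) ≤
      ∑ v, (d v : ℝ) * ((d v : ℝ) - 1) - (n * (x * b) / 2 - j / 2) := by
    rw [← hS]
    exact le_trans (Finset.sum_le_sum_of_subset_of_nonneg
      (fun v hv => Finset.mem_filter.2 ⟨Finset.mem_univ _, hUj v hv⟩)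
      fun v _ _ => mul_sub_one_nonneg (d v)) (sum_filter_mul_sub_one_le d j)
  have h2 : x * b / (2 * C₁) ≤ n * (x * b) / 2 / N := by
    rw [le_div_iff₀ hN]
    calc x * b / (2 * C₁) * N ≤ x * b / (2 * C₁) * (C₁ * n) := by gcongr
      _ = n * (x * b) / 2 := by field_simp
  have h3 : j / 2 / N ≤ x / c₁ := by
    rw [div_le_iff₀ hN]
    calc (j : ℝ) / 2 ≤ n * x / 2 := by gcongr
      _ = x / c₁ * (c₁ * n / 2) := by field_simp
      _ ≤ x / c₁ * N := by gcongr; linarith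
  -- By `hbB`, half of the drop `x * b / (2 * C₁)` pays for both errors `C₂ * x` and `x / c₁`.
  calc _ ≤ (∑ v, (d v : ℝ) * ((d v : ℝ) - 1) - (n * (x * b) / 2 - j / 2)) / N := by gcongr
    _ = (∑ v, (d v : ℝ) * ((d v : ℝ) - 1)) / N - n * (x * b) / 2 / N + j / 2 / N := by ring
    _ ≤ 1 + C₂ * x - x * b / (2 * C₁) + x / c₁ := by linarith
    _ = 1 - x * b / (4 * C₁) - x * (b - 4 * C₁ * (C₂ + 1 / c₁)) / (4 * C₁) := by
      field_simp; ring
    _ ≤ 1 - x * b / (4 * C₁) := by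
      have : 0 ≤ x * (b - 4 * C₁ * (C₂ + 1 / c₁)) / (4 * C₁) :=
        div_nonneg (mul_nonneg hx (by linarith)) (by positivity)
      linarith

set_option maxHeartbeats 400000 in
/-- The bound for paths that start at a vertex with index at least `j`, uniformly in `j`. -/
theorem exists_eventually_reachBound_le (hτ₃ : 3 < τ) (hτ₄ : τ < 4)
    (hgeneral : GeneralAssumptions τ θ d) (hextra : ExtraAssumptions τ d)
    (hcritical : Critical τ lam d) {ε : ℝ} (hε : 0 < ε) :
    ∃ A κ : ℝ, 0 < A ∧ 0 < κ ∧ ∃ K : ℕ, ∀ᶠ n : ℕ in atTop, ∀ j : ℕ, K ≤ j →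
      (j : ℝ) ≤ (n : ℝ) ^ alphaExp τ → ∀ i : Fin n, j ≤ i →
        reachBound (d n) ((totalDegree (d n) : ℝ) - 4 * phaseLength τ ε n)
          (Finset.univ.filter fun v => i < v) (phaseLength τ ε n + phaseLength τ ε n) ≤
        A * (n : ℝ) ^ (-alphaExp τ) * Real.exp (-(κ * beta τ (d n) (j + 1))) := by
  obtain ⟨c₁, C₁, hc₁, hC₁, hcC⟩ := hgeneral.totalDegree_bounds
  obtain ⟨c₀, hc₀, htail⟩ := hextra.sizeBiased
  have hα := alphaExp_pos hτ₃
  have hη := etaExp_pos hτ₃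
  have hs : 0 < τ - 3 := by linarith
  set c := c₀ / 4 ^ (τ - 2) / 2 with hc
  have hc0 : 0 < c := by positivity
  -- The excess of `nu` contributes `|lam| + 1`, replacing the total degree by `N` contributes 1,
  -- and their product at most `|lam| + 1`.
  set C₂ := 2 * |lam| + 3 with hC₂
  have hθ := hgeneral.theta_zero_pos
  -- With target level `a = A n^{-α}`, the three conditions ensure that `4 / a` is at most the
  -- largest degree, that the excess `C₂ n^{-η}` is absorbed, and that `m ≥ ε n^η / 8` steps suffice
  -- to reach `a`.
  obtain ⟨A, hA₁, hA₂, hA₃, hA0⟩ : ∃ A : ℝ, 8 / θ 0 ≤ A ∧ C₂ / c ≤ A ^ (τ - 3) ∧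
      8 / ((τ - 3) * c * ε) ≤ A ^ (τ - 3) ∧ 0 < A :=
    ((eventually_ge_atTop (8 / θ 0)).and (((tendsto_rpow_atTop hs).eventually_ge_atTop _).and
      (((tendsto_rpow_atTop hs).eventually_ge_atTop _).and (eventually_gt_atTop 0)))).exists
  set B := 4 * C₁ * (C₂ + 1 / c₁) with hB
  obtain ⟨K, hK⟩ := hgeneral.exists_eventually_le_beta B
  -- The rate is the drop `b / (4 * C₁)` of the mean, in units of `n^{-η}`, times `n^{-η} m ≥ ε /
  -- 8`.
  refine ⟨A, ε / (32 * C₁), hA0, by positivity, K, ?_⟩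
  filter_upwards [hcC, hgeneral.eventually_freeHalfEdges hτ₃ hτ₄ hε, hcritical.eventually_nu_le,
    hgeneral.eventually_le_degree_zero, hK, eventually_const_le_rpow hη 1, eventually_gt_atTop 0]
    with n ⟨hcn, hCn⟩ ⟨hN, hTN⟩ hν hdeg hβ hone hn j hKj hj i hji
  have hn' : (0 : ℝ) < n := by exact_mod_cast hn
  obtain ⟨hn0, hdeg⟩ := hdeg
  set m := phaseLength τ ε n with hm
  set T := (totalDegree (d n) : ℝ) with hT
  set N := T - 4 * m with hNdef
  set y := (n : ℝ) ^ etaExp τ with hy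
  set x := (n : ℝ) ^ (-etaExp τ) with hx
  set z := (n : ℝ) ^ (-alphaExp τ) with hz
  set S := ∑ v ∈ Finset.univ.filter (fun v : Fin n => (v : ℕ) + 1 < j + 1), (d n v : ℝ) ^ 2 with hS
  set b := beta τ (d n) (j + 1) with hb
  have hy0 : 0 < y := by positivity
  have hx0 : 0 < x := by positivity
  have hz0 : 0 < z := by positivity
  have hxy : x * y = 1 := by rw [hx, hy, ← Real.rpow_add hn']; simp
  have hx1 : x ≤ 1 := by nlinarith
  have hT0 : 0 < T := lt_of_lt_of_le (by positivity) hcn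
  have hNT : N ≤ T := by
    rw [hNdef]; linarith [(Nat.cast_nonneg m : (0 : ℝ) ≤ m)]
  have hmy : ε * y / 8 ≤ m := Nat.le_ceil _
  have hzs : z ^ (τ - 3) = x := by
    rw [hz, ← Real.rpow_mul hn'.le, neg_mul, alphaExp_mul]
  have hall : (∑ v, (d n v : ℝ) * ((d n v : ℝ) - 1)) / N ≤ 1 + C₂ * x := by
    rw [nu] at hν
    rw [div_le_iff₀ hT0] at hν
    rw [div_le_iff₀ hN]
    calc _ ≤ (1 + (|lam| + 1) * x) * T := hν
      _ ≤ (1 + (|lam| + 1) * x) * ((1 + x) * N) := by gcongr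
      _ = (1 + (|lam| + 2) * x + (|lam| + 1) * x * x) * N := by ring
      _ ≤ (1 + C₂ * x) * N := by
        refine mul_le_mul_of_nonneg_right ?_ hN.le
        have : (|lam| + 1) * x * x ≤ (|lam| + 1) * x * 1 := by gcongr
        rw [hC₂]; linarith
  have hSb : S = n * (x * b) := by
    have h1 : (n : ℝ) * x * (n : ℝ) ^ (-(2 * alphaExp τ)) = 1 := by
      rw [hx, two_mul_alphaExp hτ₃, ← Real.rpow_one_add' hn'.le, ← Real.rpow_add hn']
      · rw [show 1 + -etaExp τ + -(1 - etaExp τ) = 0 by ring, Real.rpow_zero]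
      · have := two_mul_alphaExp hτ₃
        intro h0
        linarith
    rw [hb, beta, ← hS]
    linear_combination (-S) * h1
  have hjx : (j : ℝ) ≤ n * x := by
    refine hj.trans ?_
    rw [hx, ← Real.rpow_one_add' hn'.le]
    · refine Real.rpow_le_rpow_of_exponent_le (by exact_mod_cast hn) ?_
      linarith [two_mul_alphaExp hτ₃]
    · linarith [two_mul_alphaExp hτ₃]
  have hb0 : 0 ≤ b := by rw [hb, beta]; positivity
  have hbB : B ≤ b := hβ j hKj
  set ρ := 1 - x * b / (4 * C₁) with hρ
  have hU : (∑ v ∈ Finset.univ.filter (fun v => i < v), (d n v : ℝ) * ((d n v : ℝ) - 1)) / N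
      ≤ ρ := by
    refine sum_mul_sub_one_div_le (fun v hv => ?_) hall hSb hjx hN (hNT.trans hCn) ?_ hc₁ hC₁
      hx0.le hb0 hbB
    · exact hji.trans (Fin.lt_def.1 (Finset.mem_filter.1 hv).2).le
    · exact hcn.trans (hTN.trans (by gcongr; linarith))
  have hρ1 : ρ ≤ 1 := by
    have : 0 ≤ x * b / (4 * C₁) := by positivity
    linarith
  have hρ0 : 0 ≤ ρ :=
    (div_nonneg (Finset.sum_nonneg fun v _ => mul_sub_one_nonneg (d n v)) hN.le).trans hU
  have hAzs : (A * z) ^ (τ - 3) = A ^ (τ - 3) * x := by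
    rw [Real.mul_rpow hA0.le hz0.le, hzs]
  have hmain := reachBound_add_le (m := m) (k := m) hτ₃ hτ₄ hc₀ (htail n hn0) hN hNT
    (Finset.univ.filter fun v => i < v) hall hU hρ1 (mul_pos hA0 hz0)
    (by
      refine le_trans ?_ hdeg
      rw [hz, Real.rpow_neg hn'.le, div_le_iff₀ (by positivity)]
      rw [div_le_iff₀ hθ] at hA₁
      have : (n : ℝ) ^ alphaExp τ ≠ 0 := by positivity
      field_simp
      linarith)
    (by
      rw [hAzs]
      rw [div_le_iff₀ hc0] at hA₂
      calc C₂ * x ≤ A ^ (τ - 3) * c * x := by gcongr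
        _ = _ := by rw [hc]; ring)
    (by
      rw [hAzs]
      rw [div_le_iff₀ (by positivity)] at hA₃
      calc 1 ≤ A ^ (τ - 3) * ((τ - 3) * c * ε) / 8 := by linarith
        _ = A ^ (τ - 3) * ((τ - 3) * c * ε) / 8 * (x * y) := by rw [hxy, mul_one]
        _ = A ^ (τ - 3) * x * ((τ - 3) * c * (ε * y / 8)) := by ring
        _ ≤ A ^ (τ - 3) * x * ((τ - 3) * c * m) := by gcongr)
  refine hmain.trans ?_
  rw [mul_comm]
  refine mul_le_mul_of_nonneg_left ?_ (by positivity)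
  have h1 : ρ ≤ Real.exp (-(x * b / (4 * C₁))) := by
    have := Real.add_one_le_exp (-(x * b / (4 * C₁)))
    linarith
  calc ρ ^ m ≤ Real.exp (-(x * b / (4 * C₁))) ^ m := by gcongr
    _ = Real.exp (-(x * m * b / (4 * C₁))) := by
      rw [← Real.exp_nat_mul]; congr 1; ring
    _ ≤ _ := by
      rw [Real.exp_le_exp, neg_le_neg_iff]
      have : ε / 8 ≤ x * m := by
        calc ε / 8 = ε / 8 * (x * y) := by rw [hxy, mul_one]
          _ = x * (ε * y / 8) := by ring
          _ ≤ x * m := by gcongr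
      calc ε / (32 * C₁) * b = ε / 8 * b / (4 * C₁) := by ring
        _ ≤ x * m * b / (4 * C₁) := by gcongr

end Asymptotic

end CritCM

/-! ### Summation over the starting vertices, split at the cutoff `K_n` -/

theorem mainTheorem6 (τ : ℝ) (hτ₃ : 3 < τ) (hτ₄ : τ < 4)
    (d : (n : ℕ) → Fin n → ℕ) (hd : ∀ n, Antitone (d n))
    (heven : ∀ n, Even (CritCM.totalDegree (d n)))
    (θ : ℕ → ℝ) (lam : ℝ)
    (hgeneral : CritCM.GeneralAssumptions τ θ d)
    (hextra : CritCM.ExtraAssumptions τ d)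
    (hcritical : CritCM.Critical τ lam d)
    (ε₁ ε₂ : ℝ) (hε₁ : 0 < ε₁) (hε₂ : 0 < ε₂) :
    ∃ K n₀ : ℕ, 1 ≤ K ∧ ∀ n : ℕ, n₀ ≤ n →
      (CritCM.configLaw (d n)).real
        {σ | ε₁ * (n : ℝ) ^ CritCM.etaExp τ <
          (CritCM.maxComponentDiam (CritCM.removeHubs K (CritCM.configGraph σ)) : ℝ)}
        ≤ ε₂ / 4 := by
  obtain ⟨c₁, C₁, -, hC₁, hcC⟩ := hgeneral.totalDegree_bounds
  obtain ⟨A, κ, hA, hκ, K₁, hreach⟩ :=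
    CritCM.exists_eventually_reachBound_le hτ₃ hτ₄ hgeneral hextra hcritical hε₁
  obtain ⟨Kn, hKn, hKnα, hlog, hsum⟩ := hextra.cutoff
  have hδ : 0 < ε₂ / (8 * A) := by positivity
  obtain ⟨K, hKsum, hK₁⟩ := (((hsum κ hκ).eventually_lt_const
    (ENNReal.ofReal_pos.2 hδ)).and (eventually_ge_atTop (K₁ + 1))).exists
  refine ⟨K, ?_⟩
  suffices h : ∀ᶠ n : ℕ in atTop, (CritCM.configLaw (d n)).real
        {σ | ε₁ * (n : ℝ) ^ CritCM.etaExp τ <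
          (CritCM.maxComponentDiam (CritCM.removeHubs K (CritCM.configGraph σ)) : ℝ)}
        ≤ ε₂ / 4 by
    obtain ⟨n₀, hn₀⟩ := eventually_atTop.1 h
    exact ⟨n₀, by omega, hn₀⟩
  filter_upwards [hcC, hreach, hKn.eventually_ge_atTop (K₁ + 1), hKnα.bound one_pos,
    hlog.bound (half_pos hκ), eventually_lt_of_limsup_lt hKsum,
    hgeneral.eventually_freeHalfEdges hτ₃ hτ₄ hε₁,
    CritCM.eventually_const_le_rpow (CritCM.etaExp_pos hτ₃) (12 / ε₁),
    CritCM.eventually_const_le_rpow one_pos (8 * A * C₁ / ε₂), eventually_gt_atTop 0]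
    with n ⟨_, hCn⟩ hreach hKK hKnα hlog hsumn ⟨hN, _⟩ h12 hlarge hn
  have hn' : (0 : ℝ) < n := by exact_mod_cast hn
  have hn1 : (1 : ℝ) ≤ n := by exact_mod_cast hn
  have hz0 : 0 < (n : ℝ) ^ CritCM.alphaExp τ := by positivity
  set m := CritCM.phaseLength τ ε₁ n with hm
  have hKnα : (Kn n : ℝ) ≤ (n : ℝ) ^ CritCM.alphaExp τ := by
    rw [one_mul, Real.norm_natCast, Real.norm_of_nonneg hz0.le] at hKnα
    exact hKnα
  refine (CritCM.configLaw_real_maxComponentDiam_le K (m + m) hN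
    (by push_cast; linarith) _ (fun σ hσ => ?_)).trans ?_
  -- Hence `2(2m + 1) < ε₁ n^η / 2 + 6`, which is at most `ε₁ n^η` once `n^η ≥ 12 / ε₁`.
  · have hm8 : (m : ℝ) < ε₁ * (n : ℝ) ^ CritCM.etaExp τ / 8 + 1 :=
      Nat.ceil_lt_add_one (by positivity)
    rw [div_le_iff₀ hε₁] at h12
    have hσ' : ε₁ * (n : ℝ) ^ CritCM.etaExp τ <
      (CritCM.maxComponentDiam (CritCM.removeHubs K (CritCM.configGraph σ)) : ℝ) := hσ
    have : ((2 * (m + m + 1) : ℕ) : ℝ) ≤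
        (CritCM.maxComponentDiam (CritCM.removeHubs K (CritCM.configGraph σ)) : ℝ) := by
      push_cast; linarith
    exact_mod_cast this
  rw [← Finset.sum_filter_add_sum_filter_not _ (fun i : Fin n => (i : ℕ) + 1 < Kn n),
    Finset.filter_filter, Finset.filter_filter]
  have hfirst : ∑ i ∈ Finset.univ.filter (fun i : Fin n => K < (i : ℕ) + 1 ∧ (i : ℕ) + 1 < Kn n),
      (d n i : ℝ) * CritCM.reachBound (d n) ((CritCM.totalDegree (d n) : ℝ) - 4 * m)
        (Finset.univ.filter fun v => i < v) (m + m) ≤ ε₂ / 8 := by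
    have hlt := (ENNReal.ofReal_lt_ofReal_iff hδ).1 hsumn
    calc _ ≤ ∑ i ∈ Finset.univ.filter
          (fun i : Fin n => K < (i : ℕ) + 1 ∧ (i : ℕ) + 1 < Kn n),
          A * (((d n i : ℝ) / (n : ℝ) ^ CritCM.alphaExp τ) *
            Real.exp (-(κ * CritCM.beta τ (d n) ((i : ℕ) + 1)))) := by
          refine Finset.sum_le_sum fun i hi => ?_
          obtain ⟨hKi, hiK⟩ := (Finset.mem_filter.1 hi).2
          have hi : ((i : ℕ) : ℝ) ≤ (n : ℝ) ^ CritCM.alphaExp τ := by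
            refine le_trans ?_ hKnα
            exact_mod_cast (show (i : ℕ) ≤ Kn n by omega)
          have h1 := hreach i (by omega) hi i le_rfl
          rw [Real.rpow_neg hn'.le] at h1
          calc _ ≤ (d n i : ℝ) * _ := mul_le_mul_of_nonneg_left h1 (Nat.cast_nonneg _)
            _ = _ := by ring
      _ ≤ A * (ε₂ / (8 * A)) := by
          rw [← Finset.mul_sum]
          gcongr
      _ = ε₂ / 8 := by field_simp
  have hsecond : ∑ i ∈ Finset.univ.filter
      (fun i : Fin n => K < (i : ℕ) + 1 ∧ ¬ (i : ℕ) + 1 < Kn n),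
      (d n i : ℝ) * CritCM.reachBound (d n) ((CritCM.totalDegree (d n) : ℝ) - 4 * m)
        (Finset.univ.filter fun v => i < v) (m + m) ≤ ε₂ / 8 := by
    -- The assumption `log n = o(β)` at the cutoff, used with constant `κ / 2`; the power `n^{-2}`
    -- beats the total degree, which is `O(n)`.
    have hexp : Real.exp (-(κ * CritCM.beta τ (d n) (Kn n))) ≤ ((n : ℝ) ^ 2)⁻¹ := by
      have hβ0 : 0 ≤ CritCM.beta τ (d n) (Kn n) := by rw [CritCM.beta]; positivity
      rw [Real.norm_of_nonneg (Real.log_nonneg hn1), Real.norm_of_nonneg hβ0] at hlog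
      calc _ ≤ Real.exp (-((2 : ℕ) * Real.log n)) := by
            rw [Real.exp_le_exp]; push_cast; linarith
        _ = ((n : ℝ) ^ 2)⁻¹ := by
            rw [Real.exp_neg, Real.exp_nat_mul, Real.exp_log hn']
    have hz1 : (n : ℝ) ^ (-CritCM.alphaExp τ) ≤ 1 :=
      Real.rpow_le_one_of_one_le_of_nonpos hn1 (neg_nonpos.2 (CritCM.alphaExp_pos hτ₃).le)
    calc _ ≤ ∑ i ∈ Finset.univ.filter
          (fun i : Fin n => K < (i : ℕ) + 1 ∧ ¬ (i : ℕ) + 1 < Kn n),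
          (d n i : ℝ) * (A * ((n : ℝ) ^ 2)⁻¹) := by
          refine Finset.sum_le_sum fun i hi => ?_
          obtain ⟨hKi, hiK⟩ := (Finset.mem_filter.1 hi).2
          have hj : ((Kn n - 1 : ℕ) : ℝ) ≤ (n : ℝ) ^ CritCM.alphaExp τ := by
            refine le_trans ?_ hKnα
            exact_mod_cast Nat.sub_le _ _
          -- Only the first `K_n - 1` vertices are counted as avoided: the estimate requires `j ≤
          -- n^α`, which may fail for `j = i`.
          have h1 := hreach (Kn n - 1) (by omega) hj i (by omega)
          rw [Nat.sub_add_cancel (by omega)] at h1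
          refine mul_le_mul_of_nonneg_left (h1.trans ?_) (Nat.cast_nonneg _)
          calc _ ≤ A * 1 * ((n : ℝ) ^ 2)⁻¹ := by gcongr
            _ = _ := by ring
      _ ≤ (∑ i, (d n i : ℝ)) * (A * ((n : ℝ) ^ 2)⁻¹) := by
          rw [← Finset.sum_mul]
          refine mul_le_mul_of_nonneg_right (Finset.sum_le_sum_of_subset_of_nonneg
            (Finset.filter_subset _ _) fun _ _ _ => Nat.cast_nonneg _) (by positivity)
      _ ≤ (C₁ * n) * (A * ((n : ℝ) ^ 2)⁻¹) := by
          refine mul_le_mul_of_nonneg_right ?_ (by positivity)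
          rw [CritCM.totalDegree] at hCn
          exact_mod_cast hCn
      _ = A * C₁ / n := by field_simp
      _ ≤ ε₂ / 8 := by
          rw [Real.rpow_one, div_le_iff₀ hε₂] at hlarge
          rw [div_le_iff₀ hn']
          linarith
  linarith
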